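/- Let $n\ge 1$ and let $s,s_1,s_2\in(0,1)$ satisfy $s_1+s_2=2s$. For a real-valued $K\in L^\infty(\mathbb{R}^n\times\mathbb{R}^n)$ and $z_1\ne z_2$ in $\mathbb{R}^n$ set $$A_{K,s_1,s_2}(z_1,z_2)=\int_{\mathbb{R}^n}\int_{\mathbb{R}^n}\frac{K(x,y)\,\bigl(|x-z_1|^{s_1-n}-|y-z_1|^{s_1-n}\bigr)\bigl(|x-z_2|^{s_2-n}-|y-z_2|^{s_2-n}\bigr)}{|x-y|^{n+2s}}\,dx\,dy .$$ Then there exist $\alpha>0$ and $C>0$, depending only on $n,s,s_1,s_2$, such that for every such $K$ and all $z_1\neq z_2$ in $\mathbb{R}^n$ the integral defining $A_{K,s_1,s_2}(z_1,z_2)$ converges absolutely, and $A_{K,s_1,s_2}$ satisfies the standard kernel conditions: the size condition $$|A_{K,s_1,s_2}(z_1,z_2)|\le C\,\frac{\|K\|_{L^\infty(\mathbb{R}^n\times\mathbb{R}^n)}}{|z_1-z_2|^{n}},$$ and, for every $h\in\mathbb{R}^n$ with $|h|\le\frac12|z_1-z_2|$, the regularity conditions $$|A_{K,s_1,s_2}(z_1+h,z_2)-A_{K,s_1,s_2}(z_1,z_2)|\le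 C\,\frac{|h|^{\alpha}\,\|K\|_{L^\infty(\mathbb{R}^n\times\mathbb{R}^n)}}{|z_1-z_2|^{n+\alpha}},$$ $$|A_{K,s_1,s_2}(z_1,z_2+h)-A_{K,s_1,s_2}(z_1,z_2)|\le C\,\frac{|h|^{\alpha}\,\|K\|_{L^\infty(\mathbb{R}^n\times\mathbb{R}^n)}}{|z_1-z_2|^{n+\alpha}}.$$ -/

import Mathlib

open MeasureTheory
open scoped ENNReal

noncomputable section

/-- The integrand
`K(x,y) (|x-z₁|^{s₁-n} - |y-z₁|^{s₁-n}) (|x-z₂|^{s₂-n} - |y-z₂|^{s₂-n}) / |x-y|^{n+2s}`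
as a function of the pair `(x, y) ∈ ℝⁿ × ℝⁿ`. -/
def nonlocalIntegrand (n : ℕ) (s s₁ s₂ : ℝ)
    (K : EuclideanSpace ℝ (Fin n) × EuclideanSpace ℝ (Fin n) → ℝ)
    (z₁ z₂ : EuclideanSpace ℝ (Fin n))
    (p : EuclideanSpace ℝ (Fin n) × EuclideanSpace ℝ (Fin n)) : ℝ :=
  K p * ((‖p.1 - z₁‖ ^ (s₁ - (n : ℝ)) - ‖p.2 - z₁‖ ^ (s₁ - (n : ℝ))) *
      (‖p.1 - z₂‖ ^ (s₂ - (n : ℝ)) - ‖p.2 - z₂‖ ^ (s₂ - (n : ℝ)))) /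
    ‖p.1 - p.2‖ ^ ((n : ℝ) + 2 * s)

/-- The kernel `A_{K,s₁,s₂}(z₁,z₂)`, the double integral (first in `x`, then in `y`) of the
integrand above over `ℝⁿ × ℝⁿ`. -/
def kernelA (n : ℕ) (s s₁ s₂ : ℝ)
    (K : EuclideanSpace ℝ (Fin n) × EuclideanSpace ℝ (Fin n) → ℝ)
    (z₁ z₂ : EuclideanSpace ℝ (Fin n)) : ℝ :=
  ∫ y : EuclideanSpace ℝ (Fin n), ∫ x : EuclideanSpace ℝ (Fin n),
    nonlocalIntegrand n s s₁ s₂ K z₁ z₂ (x, y)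

/-- The essential supremum norm `‖K‖_{L^∞(ℝⁿ × ℝⁿ)}`, with respect to Lebesgue measure. -/
def linftyNorm (n : ℕ)
    (K : EuclideanSpace ℝ (Fin n) × EuclideanSpace ℝ (Fin n) → ℝ) : ℝ :=
  (eLpNorm K ∞ volume).toReal

end

open MeasureTheory
open scoped ENNReal

/-! ### Radial functions with one power at the origin and another at infinity. -/

section Radial

/-! Write t = |x-y|. The increment of |·-z|^(σ-n) between x and y is at most a constant times the
sum, over r = |x-z| and r = |y-z|, of the profile r^(σ-n) min(t/r, 1)^e with e = 1: a tangent-line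
bound for t < r, trivial otherwise. No cancellation in the integral is used, so K enters only
through its sup norm, and the task is to integrate t^(-n-S) against a product of two such sums, one
for each singularity w, z. The core estimate `exists_lintegral_profileForm` gives the size dictated
by homogeneity, |w-z|^(σ₁+σ₂-n-S). For σᵢ = sᵢ and S = 2s this is |z₁-z₂|^(-n).

For regularity, moving z₁ by h produces a second difference, which is controlled by profiles at step
min(|h|, t). Splitting off a power α of the truncation extracts |h|^α and turns (σ, e) = (s₁, 1)
into (s₁-α, 1-α); the core estimate then gives |z₁-z₂|^(-n-α).

The product in the core estimate has four terms. When both profiles sit at x, the y-integral comes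
first: the truncations at r = |x-w| and ρ = |x-z| merge into one at a weighted geometric mean of r
and ρ, leaving powers of r and ρ that are integrable in x around the nearer singularity. When they
sit at different points, either one of them is comparable to its value at the other point, which
returns to the previous case, or t exceeds a third of |w-z| and the relevant distances, so that
t^(-n-S) splits into a function of x times a function of y. -/

/-- The function `‖x‖ ^ (-A)` near the origin, decaying like `‖x‖ ^ (-A-B)` beyond the scale `d`. -/
noncomputable def radialDecay (A B d r : ℝ) : ℝ := r ^ (-A) * max d r ^ (-B)

lemma radialDecay_nonneg {A B d r : ℝ} (hr : 0 ≤ r) : 0 ≤ radialDecay A B d r :=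
  mul_nonneg (Real.rpow_nonneg hr _) (Real.rpow_nonneg (le_max_of_le_right hr) _)

lemma measurable_radialDecay (A B d : ℝ) : Measurable (radialDecay A B d) := by
  unfold radialDecay; fun_prop

lemma radialDecay_scale {A B d r : ℝ} (hd : 0 < d) (hr : 0 ≤ r) :
    radialDecay A B d r = d ^ (-A - B) * radialDecay A B 1 (d⁻¹ * r) := by
  have h1 : r = d * (d⁻¹ * r) := by field_simp
  have hu : 0 ≤ d⁻¹ * r := by positivity
  generalize d⁻¹ * r = u at *
  subst h1
  have h2 : max d (d * u) = d * max 1 u := by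
    rw [mul_max_of_nonneg _ _ hd.le, mul_one]
  unfold radialDecay
  rw [h2, Real.mul_rpow hd.le hu, Real.mul_rpow hd.le (by positivity), sub_eq_add_neg,
    Real.rpow_add hd]
  ring

/-- In polar coordinates, A < n gives integrability at the origin and A + B > n at infinity. -/
lemma integrable_radialDecay {n : ℕ} (hn : 1 ≤ n) {A B : ℝ} (hA : A < n) (hAB : n < A + B) :
    Integrable (fun x : EuclideanSpace ℝ (Fin n) => radialDecay A B 1 ‖x‖) := by
  have : Nonempty (Fin n) := ⟨⟨0, hn⟩⟩
  rw [integrable_fun_norm_addHaar volume (f := radialDecay A B 1),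
    ← Set.Ioo_union_Ici_eq_Ioi (zero_lt_one' ℝ)]
  have hdim : Module.finrank ℝ (EuclideanSpace ℝ (Fin n)) = n := by simp
  rw [hdim]
  have key : ∀ {r : ℝ} (E : ℝ), 0 < r → r ^ (n - 1) * r ^ E = r ^ ((n : ℝ) - 1 + E) := by
    intro r E hr
    rw [Real.rpow_add hr, ← Real.rpow_natCast]
    push_cast [hn]
    rfl
  refine IntegrableOn.union ?_ ?_
  · refine ((intervalIntegral.integrableOn_Ioo_rpow_iff (s := (n : ℝ) - 1 + -A)
      zero_lt_one).2 (by linarith)).congr_fun (fun r hr => ?_) measurableSet_Ioo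
    simp only [radialDecay, smul_eq_mul]
    rw [max_eq_left hr.2.le, Real.one_rpow, mul_one, key _ hr.1]
  · rw [integrableOn_Ici_iff_integrableOn_Ioi]
    refine (integrableOn_Ioi_rpow_of_lt (a := (n : ℝ) - 1 + (-A + -B)) (by linarith)
      zero_lt_one).congr_fun (fun r hr => ?_) measurableSet_Ioi
    have hr' : (1 : ℝ) < r := hr
    simp only [radialDecay, smul_eq_mul]
    rw [max_eq_right hr'.le, ← Real.rpow_add (by linarith), key _ (by linarith)]

/-- Homogeneity of the integral of `radialDecay`. -/
lemma exists_lintegral_radialDecay {n : ℕ} (hn : 1 ≤ n) {A B : ℝ} (hA : A < n)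
    (hAB : n < A + B) :
    ∃ C : ℝ, 0 ≤ C ∧ ∀ d : ℝ, 0 < d → ∀ v : EuclideanSpace ℝ (Fin n),
      ∫⁻ x, ENNReal.ofReal (radialDecay A B d ‖x - v‖) = ENNReal.ofReal (C * d ^ (n - A - B)) := by
  have hint := integrable_radialDecay hn hA hAB
  refine ⟨∫ x : EuclideanSpace ℝ (Fin n), radialDecay A B 1 ‖x‖,
    integral_nonneg fun x => radialDecay_nonneg (norm_nonneg _), fun d hd v => ?_⟩
  rw [lintegral_sub_right_eq_self
    (fun x : EuclideanSpace ℝ (Fin n) => ENNReal.ofReal (radialDecay A B d ‖x‖)) v]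
  have hfun : (fun x : EuclideanSpace ℝ (Fin n) => radialDecay A B d ‖x‖) =
      fun x => d ^ (-A - B) * radialDecay A B 1 ‖d⁻¹ • x‖ := by
    funext x
    rw [radialDecay_scale hd (norm_nonneg x), norm_smul, Real.norm_of_nonneg (by positivity)]
  have hintd : Integrable (fun x : EuclideanSpace ℝ (Fin n) => radialDecay A B d ‖x‖) := by
    rw [hfun]
    exact (hint.comp_smul (inv_ne_zero hd.ne')).const_mul _
  rw [← ofReal_integral_eq_lintegral_ofReal hintd
    (Filter.Eventually.of_forall fun x => radialDecay_nonneg (norm_nonneg _)), hfun,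
    integral_const_mul, Measure.integral_comp_inv_smul_of_nonneg volume
      (fun x : EuclideanSpace ℝ (Fin n) => radialDecay A B 1 ‖x‖) hd.le]
  congr 1
  have hdim : Module.finrank ℝ (EuclideanSpace ℝ (Fin n)) = n := by simp
  rw [hdim, smul_eq_mul, ← Real.rpow_natCast, show (n : ℝ) - A - B = (-A - B) + n by ring,
    Real.rpow_add hd]
  ring

end Radial

/-! ### Increment profiles and their integral in one variable. -/

section Profile

/-- The quantity `r ^ (σ - n) * min (t / r) 1 ^ e`, controlling the increment at step `t` of a
function homogeneous of degree `σ - n`, at distance `r` from its singularity. -/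
noncomputable def profile (n : ℕ) (σ e r t : ℝ) : ℝ := r ^ (σ - n) * (t / max t r) ^ e

lemma div_max_nonneg {t r : ℝ} (ht : 0 ≤ t) : 0 ≤ t / max t r :=
  div_nonneg ht (le_max_of_le_left ht)

lemma div_max_le_one {t r : ℝ} (ht : 0 ≤ t) : t / max t r ≤ 1 :=
  div_le_one_of_le₀ (le_max_left _ _) (le_max_of_le_left ht)

lemma profile_nonneg {n : ℕ} {σ e r t : ℝ} (hr : 0 ≤ r) (ht : 0 ≤ t) : 0 ≤ profile n σ e r t :=
  mul_nonneg (Real.rpow_nonneg hr _) (Real.rpow_nonneg (div_max_nonneg ht) _)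

lemma measurable_profile (n : ℕ) (σ e : ℝ) :
    Measurable fun p : ℝ × ℝ => profile n σ e p.1 p.2 := by
  unfold profile; fun_prop

lemma profile_le_rpow {n : ℕ} {σ e r t : ℝ} (he : 0 ≤ e) (hr : 0 ≤ r) (ht : 0 ≤ t) :
    profile n σ e r t ≤ r ^ (σ - n) :=
  mul_le_of_le_one_right (Real.rpow_nonneg hr _)
    (Real.rpow_le_one (div_max_nonneg ht) (div_max_le_one ht) he)

/-- Profiles are comparable at comparable distances. -/
lemma profile_le_of_le_two_mul {n : ℕ} {σ e r r' t : ℝ} (hσ : σ ≤ n) (he : 0 ≤ e) (hr : 0 < r)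
    (hrr : r ≤ 2 * r') (ht : 0 ≤ t) :
    profile n σ e r' t ≤ 2 ^ (n - σ + e) * profile n σ e r t := by
  have hr' : 0 < r' := by linarith
  have h1 : r' ^ (σ - n) ≤ 2 ^ (n - σ) * r ^ (σ - n) := by
    calc r' ^ (σ - n) ≤ (r / 2) ^ (σ - n) :=
          Real.rpow_le_rpow_of_nonpos (by positivity) (by linarith) (by linarith)
      _ = 2 ^ (n - σ) * r ^ (σ - n) := by
          rw [Real.div_rpow hr.le (by norm_num), ← neg_sub σ, Real.rpow_neg (by norm_num)]
          field_simp
  have h2 : (t / max t r') ^ e ≤ 2 ^ e * (t / max t r) ^ e := by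
    rw [← Real.mul_rpow (by norm_num) (div_max_nonneg ht)]
    refine Real.rpow_le_rpow (div_max_nonneg ht) ?_ he
    rw [← mul_div_assoc, div_le_div_iff₀ (by positivity) (by positivity)]
    have : max t r ≤ 2 * max t r' :=
      max_le (by linarith [le_max_left t r']) (by linarith [le_max_right t r'])
    nlinarith
  calc profile n σ e r' t ≤ (2 ^ (n - σ) * r ^ (σ - n)) * (2 ^ e * (t / max t r) ^ e) := by
        unfold profile
        have := div_max_nonneg (r := r') ht
        gcongr
    _ = 2 ^ (n - σ + e) * profile n σ e r t := by
        rw [Real.rpow_add (by norm_num), profile]; ring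

/-- Interpolation of two truncations into a single one at the geometric-mean scale. -/
lemma truncation_mul_le {r ρ t p q : ℝ} (hr : 0 < r) (hρ : 0 < ρ) (ht : 0 < t) (hp : 0 ≤ p)
    (hq : 0 < q) :
    (t / max t r) ^ p * (t / max t ρ) ^ q ≤
      t ^ (p + q) * max ((r ^ p * ρ ^ q) ^ (p + q)⁻¹) t ^ (-(p + q)) := by
  have hm : 0 < p + q := by linarith
  have ht0 := ht.le
  have hR : 0 < r ^ p * ρ ^ q := by positivity
  have hmax : max ((r ^ p * ρ ^ q) ^ (p + q)⁻¹) t ^ (p + q) ≤ max t r ^ p * max t ρ ^ q := by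
    -- The geometric-mean scale R satisfies R^(p+q) = r^p ρ^q, so either value of the maximum is
    -- bounded factor by factor.
    rcases max_cases ((r ^ p * ρ ^ q) ^ (p + q)⁻¹) t with ⟨h, _⟩ | ⟨h, _⟩
    · rw [h, ← Real.rpow_mul hR.le, inv_mul_cancel₀ hm.ne', Real.rpow_one]
      gcongr <;> exact le_max_right _ _
    · rw [h, Real.rpow_add ht]
      gcongr <;> exact le_max_left _ _
  rw [Real.div_rpow ht0 (by positivity), Real.div_rpow ht0 (by positivity), div_mul_div_comm,
    ← Real.rpow_add ht, Real.rpow_neg (by positivity), ← div_eq_mul_inv]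
  gcongr

/-- The increment integral in the second variable of a product of two profiles. -/
lemma exists_lintegral_profile_mul_profile {n : ℕ} (hn : 1 ≤ n) {σ₁ σ₂ e₁ e₂ S p q : ℝ}
    (hp : 0 ≤ p) (hq : 0 < q) (hpe : p ≤ e₁) (hqe : q ≤ e₂) (hS : 0 < S) (hpq : S < p + q) :
    ∃ C : ℝ, 0 ≤ C ∧ ∀ r ρ : ℝ, 0 < r → 0 < ρ → ∀ x : EuclideanSpace ℝ (Fin n),
      ∫⁻ y, ENNReal.ofReal (‖x - y‖ ^ (-(n + S)) * profile n σ₁ e₁ r ‖x - y‖ *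
        profile n σ₂ e₂ ρ ‖x - y‖) ≤
      ENNReal.ofReal (C * (r ^ (σ₁ - n - S * p / (p + q)) * ρ ^ (σ₂ - n - S * q / (p + q)))) := by
  -- Near y = x the truncations contribute t^(p+q) against t^(-n-S), integrable since S < p + q; at
  -- infinity t^(-n-S) decays enough since S > 0.
  obtain ⟨C, hC, hrad⟩ := exists_lintegral_radialDecay hn (A := n + S - (p + q)) (B := p + q)
    (by linarith) (by linarith)
  refine ⟨C, hC, fun r ρ hr hρ x => ?_⟩
  have hm : 0 < p + q := by linarith
  set R := (r ^ p * ρ ^ q) ^ (p + q)⁻¹ with hRdef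
  have hR : 0 < R := by positivity
  have hpt : ∀ y : EuclideanSpace ℝ (Fin n), ‖x - y‖ ^ (-(n + S)) * profile n σ₁ e₁ r ‖x - y‖ *
        profile n σ₂ e₂ ρ ‖x - y‖ ≤ (r ^ (σ₁ - n) * ρ ^ (σ₂ - n)) *
          radialDecay (n + S - (p + q)) (p + q) R ‖y - x‖ := by
    intro y
    rw [norm_sub_rev y x]
    rcases (norm_nonneg (x - y)).eq_or_lt with h0 | ht
    -- On the diagonal a negative power of 0 is 0 by convention.
    · rw [← h0, Real.zero_rpow (neg_lt_zero.2 (by positivity)).ne, zero_mul, zero_mul]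
      exact mul_nonneg (by positivity) (radialDecay_nonneg le_rfl)
    · generalize ‖x - y‖ = t at *
      have ht0 := ht.le
      have h1 : (t / max t r) ^ e₁ ≤ (t / max t r) ^ p :=
        Real.rpow_le_rpow_of_exponent_ge (by positivity) (div_max_le_one ht0) hpe
      have h2 : (t / max t ρ) ^ e₂ ≤ (t / max t ρ) ^ q :=
        Real.rpow_le_rpow_of_exponent_ge (by positivity) (div_max_le_one ht0) hqe
      have h3 := truncation_mul_le hr hρ ht hp hq
      calc t ^ (-(n + S)) * profile n σ₁ e₁ r t * profile n σ₂ e₂ ρ t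
          = (r ^ (σ₁ - n) * ρ ^ (σ₂ - n)) * (t ^ (-(n + S)) *
              ((t / max t r) ^ e₁ * (t / max t ρ) ^ e₂)) := by unfold profile; ring
        _ ≤ (r ^ (σ₁ - n) * ρ ^ (σ₂ - n)) * (t ^ (-(n + S)) *
              (t ^ (p + q) * max R t ^ (-(p + q)))) := by
            refine mul_le_mul_of_nonneg_left (mul_le_mul_of_nonneg_left ?_ (by positivity))
              (by positivity)
            exact (mul_le_mul h1 h2 (by positivity) (by positivity)).trans h3
        _ = _ := by
            unfold radialDecay
            rw [show -((n : ℝ) + S - (p + q)) = -(n + S) + (p + q) by ring, Real.rpow_add ht _ (p + q)]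
            ring
  calc _ ≤ ∫⁻ y, ENNReal.ofReal (r ^ (σ₁ - n) * ρ ^ (σ₂ - n)) * ENNReal.ofReal
          (radialDecay (n + S - (p + q)) (p + q) R ‖y - x‖) := by
        refine lintegral_mono fun y => ?_
        rw [← ENNReal.ofReal_mul (by positivity)]
        exact ENNReal.ofReal_le_ofReal (hpt y)
    _ = ENNReal.ofReal ((r ^ (σ₁ - n) * ρ ^ (σ₂ - n)) * (C * R ^ (-S))) := by
        rw [lintegral_const_mul' _ _ ENNReal.ofReal_ne_top, hrad R hR x,
          ← ENNReal.ofReal_mul (by positivity),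
          show (n : ℝ) - (n + S - (p + q)) - (p + q) = -S by ring]
    _ = _ := by
        congr 1
        rw [hRdef, ← Real.rpow_mul (by positivity), Real.mul_rpow (by positivity) (by positivity),
          ← Real.rpow_mul hr.le, ← Real.rpow_mul hρ.le,
          show σ₁ - n - S * p / (p + q) = (σ₁ - n) + p * ((p + q)⁻¹ * -S) by field_simp; ring,
          show σ₂ - n - S * q / (p + q) = (σ₂ - n) + q * ((p + q)⁻¹ * -S) by field_simp; ring,
          Real.rpow_add hr, Real.rpow_add hρ]
        ring

end Profile

/-! ### The double integral of two profiles against the fractional kernel. -/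

section DoubleIntegrals

variable {n : ℕ}

lemma measurable_profile_norm {X : Type*} [MeasurableSpace X] (σ e : ℝ)
    {f g : X → EuclideanSpace ℝ (Fin n)} (hf : Measurable f) (hg : Measurable g) :
    Measurable fun p => profile n σ e ‖f p‖ ‖g p‖ :=
  (measurable_profile n σ e).comp (hf.norm.prodMk hg.norm)

/-- The product of two profiles against the fractional kernel. -/
noncomputable def profilePair (n : ℕ) (σ₁ e₁ σ₂ e₂ S r ρ t : ℝ) : ℝ :=
  t ^ (-(n + S)) * profile n σ₁ e₁ r t * profile n σ₂ e₂ ρ t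

lemma profilePair_nonneg {σ₁ e₁ σ₂ e₂ S r ρ t : ℝ} (hr : 0 ≤ r) (hρ : 0 ≤ ρ) (ht : 0 ≤ t) :
    0 ≤ profilePair n σ₁ e₁ σ₂ e₂ S r ρ t :=
  mul_nonneg (mul_nonneg (Real.rpow_nonneg ht _) (profile_nonneg hr ht)) (profile_nonneg hρ ht)

lemma profilePair_comm (σ₁ e₁ σ₂ e₂ S r ρ t : ℝ) :
    profilePair n σ₁ e₁ σ₂ e₂ S r ρ t = profilePair n σ₂ e₂ σ₁ e₁ S ρ r t := by
  unfold profilePair; ring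

lemma measurable_profilePair_norm {X : Type*} [MeasurableSpace X] (σ₁ e₁ σ₂ e₂ S : ℝ)
    {f g h : X → EuclideanSpace ℝ (Fin n)} (hf : Measurable f) (hg : Measurable g)
    (hh : Measurable h) :
    Measurable fun p => profilePair n σ₁ e₁ σ₂ e₂ S ‖f p‖ ‖g p‖ ‖h p‖ :=
  ((hh.norm.pow_const _).mul (measurable_profile_norm _ _ hf hh)).mul
    (measurable_profile_norm _ _ hg hh)

/-- The increment integral of two profiles, bounded by a radial function centred at the singularity
that is closer. -/
lemma exists_lintegral_le_radialDecay (hn : 1 ≤ n) {σ₁ σ₂ e₁ e₂ S : ℝ} (hσ₁ : 0 < σ₁)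
    (hσ₂ : 0 < σ₂) (hσ₂' : σ₂ ≤ n) (he₁ : σ₁ ≤ e₁) (he₂ : σ₂ ≤ e₂)
    (hS : 0 < S) (hS₁ : S < σ₁ + e₂) :
    ∃ C A B : ℝ, 0 ≤ C ∧ A < n ∧ A + B = 2 * n - σ₁ - σ₂ + S ∧
      ∀ w z x : EuclideanSpace ℝ (Fin n), w ≠ z → x ≠ w → ‖x - w‖ ≤ ‖x - z‖ →
        ∫⁻ y, ENNReal.ofReal (profilePair n σ₁ e₁ σ₂ e₂ S ‖x - w‖ ‖x - z‖ ‖x - y‖) ≤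
        ENNReal.ofReal (C * radialDecay A B (‖w - z‖ / 2) ‖x - w‖) := by
  have he₂0 : 0 < e₂ := hσ₂.trans_le he₂
  have hm : 0 < σ₁ + e₂ := by linarith
  -- The truncation at the nearer singularity w is weakened from e₁ to σ₁. The y-integral then
  -- worsens the power of |x-w| by Sσ₁/(σ₁+e₂), which is below σ₁ exactly when S < σ₁ + e₂, keeping
  -- that power integrable.
  obtain ⟨C, hC, hint⟩ := exists_lintegral_profile_mul_profile hn (σ₁ := σ₁) (σ₂ := σ₂)
    hσ₁.le he₂0 he₁ le_rfl hS hS₁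
  have hB : 0 ≤ n - σ₂ + S * e₂ / (σ₁ + e₂) := by
    have : 0 ≤ S * e₂ / (σ₁ + e₂) := by positivity
    linarith
  have hA : S * σ₁ / (σ₁ + e₂) < σ₁ := by
    rw [div_lt_iff₀ hm]; nlinarith
  refine ⟨C, n - σ₁ + S * σ₁ / (σ₁ + e₂), n - σ₂ + S * e₂ / (σ₁ + e₂), hC, by linarith,
    by field_simp; ring, fun w z x hwz hxw hle => ?_⟩
  have hd : 0 < ‖w - z‖ := norm_pos_iff.2 (sub_ne_zero.2 hwz)
  have htri : ‖w - z‖ ≤ ‖x - w‖ + ‖x - z‖ := by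
    calc ‖w - z‖ = ‖(x - z) - (x - w)‖ := by congr 1; abel
      _ ≤ _ := by rw [add_comm]; exact norm_sub_le _ _
  have hr : 0 < ‖x - w‖ := norm_pos_iff.2 (sub_ne_zero.2 hxw)
  have hρ : 0 < ‖x - z‖ := hr.trans_le hle
  refine (hint _ _ hr hρ x).trans (ENNReal.ofReal_le_ofReal ?_)
  refine mul_le_mul_of_nonneg_left ?_ hC
  unfold radialDecay
  rw [show σ₁ - n - S * σ₁ / (σ₁ + e₂) = -(n - σ₁ + S * σ₁ / (σ₁ + e₂)) by ring,
    show σ₂ - n - S * e₂ / (σ₁ + e₂) = -(n - σ₂ + S * e₂ / (σ₁ + e₂)) by ring]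
  refine mul_le_mul_of_nonneg_left ?_ (by positivity)
  -- The farther distance |x-z| is at least |x-w|, hence at least half of |w-z|.
  exact Real.rpow_le_rpow_of_nonpos (lt_max_of_lt_right hr)
    (max_le (by linarith) hle) (by linarith)


/-- Space is divided according to which singularity is nearer to x; `hS₁` serves the half near w and
`hS₂` the half near z. Both radial bounds have the same total degree, hence the same power of |w-z|.
-/
lemma exists_lintegral_profilePair_fst_fst (hn : 1 ≤ n) {σ₁ σ₂ e₁ e₂ S : ℝ} (hσ₁ : 0 < σ₁)
    (hσ₁' : σ₁ ≤ n) (hσ₂ : 0 < σ₂) (hσ₂' : σ₂ ≤ n) (he₁ : σ₁ ≤ e₁) (he₂ : σ₂ ≤ e₂)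
    (hS : 0 < S) (hS₁ : S < σ₁ + e₂) (hS₂ : S < σ₂ + e₁) (hσS : σ₁ + σ₂ ≤ S) :
    ∃ C : ℝ, 0 ≤ C ∧ ∀ w z : EuclideanSpace ℝ (Fin n), w ≠ z →
      ∫⁻ p : EuclideanSpace ℝ (Fin n) × EuclideanSpace ℝ (Fin n),
        ENNReal.ofReal (profilePair n σ₁ e₁ σ₂ e₂ S ‖p.1 - w‖ ‖p.1 - z‖ ‖p.1 - p.2‖) ≤
      ENNReal.ofReal (C * ‖w - z‖ ^ (σ₁ + σ₂ - n - S)) := by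
  have hn' : (1 : ℝ) ≤ n := by exact_mod_cast hn
  have : Nonempty (Fin n) := ⟨⟨0, hn⟩⟩
  obtain ⟨C₁, A₁, B₁, hC₁, hA₁, hAB₁, h₁⟩ :=
    exists_lintegral_le_radialDecay hn hσ₁ hσ₂ hσ₂' he₁ he₂ hS hS₁
  obtain ⟨C₂, A₂, B₂, hC₂, hA₂, hAB₂, h₂⟩ :=
    exists_lintegral_le_radialDecay hn hσ₂ hσ₁ hσ₁' he₂ he₁ hS hS₂
  obtain ⟨D₁, hD₁, hr₁⟩ := exists_lintegral_radialDecay hn (B := B₁) hA₁ (by linarith)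
  obtain ⟨D₂, hD₂, hr₂⟩ := exists_lintegral_radialDecay hn (B := B₂) hA₂ (by linarith)
  refine ⟨(C₁ * D₁ + C₂ * D₂) * 2⁻¹ ^ (σ₁ + σ₂ - n - S), by positivity, fun w z hwz => ?_⟩
  have hd : 0 < ‖w - z‖ / 2 := half_pos (norm_pos_iff.2 (sub_ne_zero.2 hwz))
  rw [Measure.volume_eq_prod, lintegral_prod _ (measurable_profilePair_norm _ _ _ _ _
    (by fun_prop) (by fun_prop) (by fun_prop)).ennreal_ofReal.aemeasurable]
  have hae : ∀ᵐ x : EuclideanSpace ℝ (Fin n), x ≠ w ∧ x ≠ z :=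
    (Measure.ae_ne volume w).and (Measure.ae_ne volume z)
  calc _ ≤ ∫⁻ x, (ENNReal.ofReal C₁ * ENNReal.ofReal (radialDecay A₁ B₁ (‖w - z‖ / 2) ‖x - w‖) +
          ENNReal.ofReal C₂ * ENNReal.ofReal (radialDecay A₂ B₂ (‖w - z‖ / 2) ‖x - z‖)) := by
        refine lintegral_mono_ae (hae.mono fun x hx => ?_)
        rw [← ENNReal.ofReal_mul hC₁, ← ENNReal.ofReal_mul hC₂]
        rcases le_total ‖x - w‖ ‖x - z‖ with hle | hle
        · exact (h₁ w z x hwz hx.1 hle).trans le_self_add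
        · have := h₂ z w x hwz.symm hx.2 hle
          simp only [profilePair_comm σ₂] at this
          rw [norm_sub_rev z w] at this
          exact this.trans le_add_self
    _ = _ := by
        have hmeas : ∀ (A B d : ℝ) (v : EuclideanSpace ℝ (Fin n)),
            Measurable fun x => ENNReal.ofReal (radialDecay A B d ‖x - v‖) := fun A B d v =>
          ((measurable_radialDecay A B d).comp (by fun_prop)).ennreal_ofReal
        rw [lintegral_add_left ((hmeas _ _ _ _).const_mul _), lintegral_const_mul _ (hmeas _ _ _ _),
          lintegral_const_mul _ (hmeas _ _ _ _), hr₁ _ hd, hr₂ _ hd, ← ENNReal.ofReal_mul hC₁,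
          ← ENNReal.ofReal_mul hC₂, ← ENNReal.ofReal_add (by positivity) (by positivity),
          show (n : ℝ) - A₁ - B₁ = σ₁ + σ₂ - n - S by linarith,
          show (n : ℝ) - A₂ - B₂ = σ₁ + σ₂ - n - S by linarith, div_eq_mul_inv,
          Real.mul_rpow (norm_nonneg _) (by norm_num)]
        congr 1
        ring

/-- Pointwise reduction of the product of profiles at different points to products of profiles at
the same point, up to a remainder with separated variables. -/
lemma profilePair_le_add {σ₁ σ₂ e₁ e₂ S c d r r' ρ ρ' t : ℝ} (hσ₁ : σ₁ ≤ n)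
    (hσ₂ : σ₂ ≤ n) (he₁ : 0 ≤ e₁) (he₂ : 0 ≤ e₂) (hc₁ : 0 ≤ σ₁ + c) (hc₂ : 0 ≤ σ₂ + c)
    (hc : (σ₁ + c) + (σ₂ + c) = n + S)
    (hr : 0 < r) (hr' : 0 < r') (hρ : 0 < ρ) (hρ' : 0 < ρ') (hd : 0 < d)
    (hrt : r' ≤ t + r) (hρt : ρ ≤ t + ρ') (hdt : d ≤ r + t + ρ') (ht : 0 ≤ t) :
    profilePair n σ₁ e₁ σ₂ e₂ S r ρ' t ≤
      2 ^ (n - σ₂ + e₂) * profilePair n σ₁ e₁ σ₂ e₂ S r ρ t +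
      2 ^ (n - σ₁ + e₁) * profilePair n σ₁ e₁ σ₂ e₂ S r' ρ' t +
      radialDecay (n - σ₁) (σ₁ + c) (d / 3) r * radialDecay (n - σ₂) (σ₂ + c) (d / 3) ρ' := by
  have hP : ∀ {a b : ℝ}, 0 < a → 0 < b → 0 ≤ profilePair n σ₁ e₁ σ₂ e₂ S a b t :=
    fun ha hb => profilePair_nonneg ha.le hb.le ht
  have t1 : 0 ≤ 2 ^ (n - σ₂ + e₂) * profilePair n σ₁ e₁ σ₂ e₂ S r ρ t :=
    mul_nonneg (by positivity) (hP hr hρ)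
  have t2 : 0 ≤ 2 ^ (n - σ₁ + e₁) * profilePair n σ₁ e₁ σ₂ e₂ S r' ρ' t :=
    mul_nonneg (by positivity) (hP hr' hρ')
  have t3 : 0 ≤ radialDecay (n - σ₁) (σ₁ + c) (d / 3) r *
      radialDecay (n - σ₂) (σ₂ + c) (d / 3) ρ' :=
    mul_nonneg (radialDecay_nonneg hr.le) (radialDecay_nonneg hρ'.le)
  rcases le_or_gt ρ (2 * ρ') with h | h
  · have := profile_le_of_le_two_mul hσ₂ he₂ hρ h ht
    have h0 : 0 ≤ t ^ (-(n + S)) * profile n σ₁ e₁ r t :=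
      mul_nonneg (Real.rpow_nonneg ht _) (profile_nonneg hr.le ht)
    have h1 := mul_le_mul_of_nonneg_left this h0
    have h2 : profilePair n σ₁ e₁ σ₂ e₂ S r ρ' t ≤
        2 ^ (n - σ₂ + e₂) * profilePair n σ₁ e₁ σ₂ e₂ S r ρ t := by
      unfold profilePair; linarith
    linarith
  rcases le_or_gt r' (2 * r) with h' | h'
  · have := profile_le_of_le_two_mul hσ₁ he₁ hr' h' ht
    have h0 : 0 ≤ t ^ (-(n + S)) * profile n σ₂ e₂ ρ' t :=
      mul_nonneg (Real.rpow_nonneg ht _) (profile_nonneg hρ'.le ht)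
    have h1 := mul_le_mul_of_nonneg_left this h0
    have h2 : profilePair n σ₁ e₁ σ₂ e₂ S r ρ' t ≤
        2 ^ (n - σ₁ + e₁) * profilePair n σ₁ e₁ σ₂ e₂ S r' ρ' t := by
      unfold profilePair; linarith
    linarith
  -- Here r' > 2r and ρ > 2ρ', so the triangle inequalities give t > r and t > ρ', hence d < 3t.
  have ht' : 0 < t := by linarith
  have h1 : profilePair n σ₁ e₁ σ₂ e₂ S r ρ' t ≤
      t ^ (-(n + S)) * r ^ (σ₁ - n) * ρ' ^ (σ₂ - n) := by
    unfold profilePair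
    have := profile_nonneg (n := n) (σ := σ₂) (e := e₂) hρ'.le ht
    gcongr <;> exact profile_le_rpow ‹_› (le_of_lt ‹_›) ht
  have h2 : t ^ (-(n + S)) ≤ max (d / 3) r ^ (-(σ₁ + c)) * max (d / 3) ρ' ^ (-(σ₂ + c)) := by
    rw [← hc, neg_add, Real.rpow_add ht']
    have hd3 : d / 3 ≤ t := by linarith
    gcongr ?_ * ?_
    · exact Real.rpow_le_rpow_of_nonpos (by positivity) (max_le hd3 (by linarith)) (by linarith)
    · exact Real.rpow_le_rpow_of_nonpos (by positivity) (max_le hd3 (by linarith)) (by linarith)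
  have h3 : profilePair n σ₁ e₁ σ₂ e₂ S r ρ' t ≤ radialDecay (n - σ₁) (σ₁ + c) (d / 3) r *
      radialDecay (n - σ₂) (σ₂ + c) (d / 3) ρ' := by
    refine h1.trans ?_
    unfold radialDecay
    rw [neg_sub, neg_sub]
    have : 0 ≤ r ^ (σ₁ - n) * ρ' ^ (σ₂ - n) := by positivity
    calc _ = t ^ (-(n + S)) * (r ^ (σ₁ - n) * ρ' ^ (σ₂ - n)) := by ring
      _ ≤ _ := mul_le_mul_of_nonneg_right h2 this
      _ = _ := by ring
  linarith

lemma lintegral_profilePair_snd_snd (σ₁ e₁ σ₂ e₂ S : ℝ) (w z : EuclideanSpace ℝ (Fin n)) :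
    ∫⁻ p : EuclideanSpace ℝ (Fin n) × EuclideanSpace ℝ (Fin n),
        ENNReal.ofReal (profilePair n σ₁ e₁ σ₂ e₂ S ‖p.2 - w‖ ‖p.2 - z‖ ‖p.1 - p.2‖) =
      ∫⁻ p : EuclideanSpace ℝ (Fin n) × EuclideanSpace ℝ (Fin n),
        ENNReal.ofReal (profilePair n σ₁ e₁ σ₂ e₂ S ‖p.1 - w‖ ‖p.1 - z‖ ‖p.1 - p.2‖) := by
  rw [Measure.volume_eq_prod, ← lintegral_prod_swap]
  simp only [Prod.fst_swap, Prod.snd_swap, norm_sub_rev]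

lemma lintegral_profilePair_snd_fst (σ₁ e₁ σ₂ e₂ S : ℝ) (w z : EuclideanSpace ℝ (Fin n)) :
    ∫⁻ p : EuclideanSpace ℝ (Fin n) × EuclideanSpace ℝ (Fin n),
        ENNReal.ofReal (profilePair n σ₁ e₁ σ₂ e₂ S ‖p.2 - w‖ ‖p.1 - z‖ ‖p.1 - p.2‖) =
      ∫⁻ p : EuclideanSpace ℝ (Fin n) × EuclideanSpace ℝ (Fin n),
        ENNReal.ofReal (profilePair n σ₁ e₁ σ₂ e₂ S ‖p.1 - w‖ ‖p.2 - z‖ ‖p.1 - p.2‖) := by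
  rw [Measure.volume_eq_prod, ← lintegral_prod_swap]
  simp only [Prod.fst_swap, Prod.snd_swap, norm_sub_rev]

/-- By `profilePair_le_add`, two same-point integrals and a product of two independent radial
integrals suffice. -/
lemma exists_lintegral_profilePair_fst_snd (hn : 1 ≤ n) {σ₁ σ₂ e₁ e₂ S : ℝ} (hσ₁ : 0 < σ₁)
    (hσ₁' : σ₁ ≤ n) (hσ₂ : 0 < σ₂) (hσ₂' : σ₂ ≤ n) (he₁ : σ₁ ≤ e₁) (he₂ : σ₂ ≤ e₂)
    (hS : 0 < S) (hS₁ : S < σ₁ + e₂) (hS₂ : S < σ₂ + e₁) (hσS : σ₁ + σ₂ ≤ S) :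
    ∃ C : ℝ, 0 ≤ C ∧ ∀ w z : EuclideanSpace ℝ (Fin n), w ≠ z →
      ∫⁻ p : EuclideanSpace ℝ (Fin n) × EuclideanSpace ℝ (Fin n),
        ENNReal.ofReal (profilePair n σ₁ e₁ σ₂ e₂ S ‖p.1 - w‖ ‖p.2 - z‖ ‖p.1 - p.2‖) ≤
      ENNReal.ofReal (C * ‖w - z‖ ^ (σ₁ + σ₂ - n - S)) := by
  have hn' : (1 : ℝ) ≤ n := by exact_mod_cast hn
  have : Nonempty (Fin n) := ⟨⟨0, hn⟩⟩
  obtain ⟨C₀, hC₀, h₀⟩ := exists_lintegral_profilePair_fst_fst hn hσ₁ hσ₁' hσ₂ hσ₂' he₁ he₂ hS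
    hS₁ hS₂ hσS
  -- This splits the exponent n + S as (σ₁+c) + (σ₂+c), so that both radial factors decay with total
  -- degree n + c > n.
  obtain ⟨c, hc⟩ : ∃ c, c = (n + S - σ₁ - σ₂) / 2 := ⟨_, rfl⟩
  have hc0 : 0 < c := by linarith
  obtain ⟨D₁, hD₁, hr₁⟩ := exists_lintegral_radialDecay hn (A := n - σ₁) (B := σ₁ + c)
    (by linarith) (by linarith)
  obtain ⟨D₂, hD₂, hr₂⟩ := exists_lintegral_radialDecay hn (A := n - σ₂) (B := σ₂ + c)
    (by linarith) (by linarith)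
  refine ⟨2 ^ (n - σ₂ + e₂) * C₀ + 2 ^ (n - σ₁ + e₁) * C₀ +
    D₁ * D₂ * 3⁻¹ ^ (σ₁ + σ₂ - n - S), by positivity, fun w z hwz => ?_⟩
  have hd : 0 < ‖w - z‖ := norm_pos_iff.2 (sub_ne_zero.2 hwz)
  have hd3 : 0 < ‖w - z‖ / 3 := by positivity
  have hae : ∀ᵐ x : EuclideanSpace ℝ (Fin n), x ≠ w ∧ x ≠ z :=
    (Measure.ae_ne volume w).and (Measure.ae_ne volume z)
  have hae₂ : ∀ᵐ p : EuclideanSpace ℝ (Fin n) × EuclideanSpace ℝ (Fin n),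
      (p.1 ≠ w ∧ p.1 ≠ z) ∧ (p.2 ≠ w ∧ p.2 ≠ z) :=
    (Measure.quasiMeasurePreserving_fst.ae hae).and (Measure.quasiMeasurePreserving_snd.ae hae)
  have hpos : ∀ {x v : EuclideanSpace ℝ (Fin n)}, x ≠ v → 0 < ‖x - v‖ :=
    fun h => norm_pos_iff.2 (sub_ne_zero.2 h)
  have hmeas : ∀ (A B d : ℝ) (v : EuclideanSpace ℝ (Fin n)),
      Measurable fun x => ENNReal.ofReal (radialDecay A B d ‖x - v‖) := fun A B d v =>
    ((measurable_radialDecay A B d).comp (by fun_prop)).ennreal_ofReal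
  calc _ ≤ ∫⁻ p : EuclideanSpace ℝ (Fin n) × EuclideanSpace ℝ (Fin n),
          (ENNReal.ofReal (2 ^ (n - σ₂ + e₂)) * ENNReal.ofReal
            (profilePair n σ₁ e₁ σ₂ e₂ S ‖p.1 - w‖ ‖p.1 - z‖ ‖p.1 - p.2‖) +
          ENNReal.ofReal (2 ^ (n - σ₁ + e₁)) * ENNReal.ofReal
            (profilePair n σ₁ e₁ σ₂ e₂ S ‖p.2 - w‖ ‖p.2 - z‖ ‖p.1 - p.2‖) +
          ENNReal.ofReal (radialDecay (n - σ₁) (σ₁ + c) (‖w - z‖ / 3) ‖p.1 - w‖) *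
            ENNReal.ofReal (radialDecay (n - σ₂) (σ₂ + c) (‖w - z‖ / 3) ‖p.2 - z‖)) := by
        refine lintegral_mono_ae (hae₂.mono fun p ⟨⟨h1, h2⟩, ⟨h3, h4⟩⟩ => ?_)
        have hP : ∀ x, 0 ≤ profilePair n σ₁ e₁ σ₂ e₂ S ‖x - w‖ ‖x - z‖ ‖p.1 - p.2‖ :=
          fun x => profilePair_nonneg (norm_nonneg _) (norm_nonneg _) (norm_nonneg _)
        have hR : ∀ A B d (v : EuclideanSpace ℝ (Fin n)), 0 ≤ radialDecay A B d ‖v‖ :=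
          fun A B d v => radialDecay_nonneg (norm_nonneg _)
        rw [← ENNReal.ofReal_mul (by positivity), ← ENNReal.ofReal_mul (by positivity),
          ← ENNReal.ofReal_mul (hR _ _ _ _),
          ← ENNReal.ofReal_add (mul_nonneg (by positivity) (hP _))
            (mul_nonneg (by positivity) (hP _)),
          ← ENNReal.ofReal_add (add_nonneg (mul_nonneg (by positivity) (hP _))
            (mul_nonneg (by positivity) (hP _))) (mul_nonneg (hR _ _ _ _) (hR _ _ _ _))]
        refine ENNReal.ofReal_le_ofReal (profilePair_le_add hσ₁' hσ₂' (by linarith) (by linarith)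
          (by linarith) (by linarith) (by linarith) (hpos h1) (hpos h3) (hpos h2) (hpos h4) hd
          ?_ ?_ ?_ (norm_nonneg _))
        · rw [norm_sub_rev p.1 p.2]; exact norm_sub_le_norm_sub_add_norm_sub _ _ _
        · exact norm_sub_le_norm_sub_add_norm_sub _ _ _
        · rw [norm_sub_rev p.1 w]
          linarith [norm_sub_le_norm_sub_add_norm_sub w p.1 z,
            norm_sub_le_norm_sub_add_norm_sub p.1 p.2 z]
    _ ≤ ENNReal.ofReal (2 ^ (n - σ₂ + e₂)) * ENNReal.ofReal
            (C₀ * ‖w - z‖ ^ (σ₁ + σ₂ - n - S)) +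
          ENNReal.ofReal (2 ^ (n - σ₁ + e₁)) * ENNReal.ofReal
            (C₀ * ‖w - z‖ ^ (σ₁ + σ₂ - n - S)) +
          ENNReal.ofReal (D₁ * (‖w - z‖ / 3) ^ (-c)) *
            ENNReal.ofReal (D₂ * (‖w - z‖ / 3) ^ (-c)) := by
        have hm₁ : Measurable fun p : EuclideanSpace ℝ (Fin n) × EuclideanSpace ℝ (Fin n) =>
            ENNReal.ofReal (profilePair n σ₁ e₁ σ₂ e₂ S ‖p.1 - w‖ ‖p.1 - z‖ ‖p.1 - p.2‖) :=
          (measurable_profilePair_norm _ _ _ _ _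
            (by fun_prop) (by fun_prop) (by fun_prop)).ennreal_ofReal
        have hm₂ : Measurable fun p : EuclideanSpace ℝ (Fin n) × EuclideanSpace ℝ (Fin n) =>
            ENNReal.ofReal (profilePair n σ₁ e₁ σ₂ e₂ S ‖p.2 - w‖ ‖p.2 - z‖ ‖p.1 - p.2‖) :=
          (measurable_profilePair_norm _ _ _ _ _
            (by fun_prop) (by fun_prop) (by fun_prop)).ennreal_ofReal
        rw [lintegral_add_left ((hm₁.const_mul _).fun_add (hm₂.const_mul _)),
          lintegral_add_left (hm₁.const_mul _), lintegral_const_mul _ hm₁,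
          lintegral_const_mul _ hm₂, lintegral_profilePair_snd_snd,
          Measure.volume_eq_prod, lintegral_prod_mul (hmeas _ _ _ _).aemeasurable
            (hmeas _ _ _ _).aemeasurable, hr₁ _ hd3, hr₂ _ hd3,
          show (n : ℝ) - (n - σ₁) - (σ₁ + c) = -c by ring,
          show (n : ℝ) - (n - σ₂) - (σ₂ + c) = -c by ring, ← Measure.volume_eq_prod]
        gcongr <;> exact h₀ w z hwz
    _ = _ := by
        rw [← ENNReal.ofReal_mul (by positivity), ← ENNReal.ofReal_mul (by positivity),
          ← ENNReal.ofReal_mul (by positivity), ← ENNReal.ofReal_add (by positivity)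
          (by positivity), ← ENNReal.ofReal_add (by positivity) (by positivity)]
        congr 1
        rw [show D₁ * (‖w - z‖ / 3) ^ (-c) * (D₂ * (‖w - z‖ / 3) ^ (-c)) =
            D₁ * D₂ * ((‖w - z‖ / 3) ^ (-c) * (‖w - z‖ / 3) ^ (-c)) by ring,
          ← Real.rpow_add hd3, show -c + -c = σ₁ + σ₂ - n - S by linarith, div_eq_mul_inv,
          Real.mul_rpow (norm_nonneg _) (by norm_num)]
        ring

/-- The fractional kernel against sums of profiles at both points. -/
noncomputable def profileForm (n : ℕ) (σ₁ e₁ σ₂ e₂ S : ℝ) (w z : EuclideanSpace ℝ (Fin n))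
    (p : EuclideanSpace ℝ (Fin n) × EuclideanSpace ℝ (Fin n)) : ℝ :=
  ‖p.1 - p.2‖ ^ (-(n + S)) *
    ((profile n σ₁ e₁ ‖p.1 - w‖ ‖p.1 - p.2‖ + profile n σ₁ e₁ ‖p.2 - w‖ ‖p.1 - p.2‖) *
      (profile n σ₂ e₂ ‖p.1 - z‖ ‖p.1 - p.2‖ + profile n σ₂ e₂ ‖p.2 - z‖ ‖p.1 - p.2‖))

lemma profileForm_nonneg (σ₁ e₁ σ₂ e₂ S : ℝ) (w z : EuclideanSpace ℝ (Fin n))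
    (p : EuclideanSpace ℝ (Fin n) × EuclideanSpace ℝ (Fin n)) :
    0 ≤ profileForm n σ₁ e₁ σ₂ e₂ S w z p := by
  have h : ∀ σ e (v : EuclideanSpace ℝ (Fin n)), 0 ≤ profile n σ e ‖v‖ ‖p.1 - p.2‖ :=
    fun σ e v => profile_nonneg (norm_nonneg _) (norm_nonneg _)
  exact mul_nonneg (Real.rpow_nonneg (norm_nonneg _) _)
    (mul_nonneg (add_nonneg (h _ _ _) (h _ _ _)) (add_nonneg (h _ _ _) (h _ _ _)))

lemma measurable_profileForm (σ₁ e₁ σ₂ e₂ S : ℝ) (w z : EuclideanSpace ℝ (Fin n)) :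
    Measurable (profileForm n σ₁ e₁ σ₂ e₂ S w z) := by
  have hx : ∀ σ e (v : EuclideanSpace ℝ (Fin n)), Measurable fun p :
      EuclideanSpace ℝ (Fin n) × EuclideanSpace ℝ (Fin n) => profile n σ e ‖p.1 - v‖ ‖p.1 - p.2‖ :=
    fun σ e v => measurable_profile_norm σ e (by fun_prop) (by fun_prop)
  have hy : ∀ σ e (v : EuclideanSpace ℝ (Fin n)), Measurable fun p :
      EuclideanSpace ℝ (Fin n) × EuclideanSpace ℝ (Fin n) => profile n σ e ‖p.2 - v‖ ‖p.1 - p.2‖ :=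
    fun σ e v => measurable_profile_norm σ e (by fun_prop) (by fun_prop)
  unfold profileForm
  exact Measurable.fun_mul (by fun_prop)
    (((hx _ _ _).fun_add (hy _ _ _)).fun_mul ((hx _ _ _).fun_add (hy _ _ _)))

/-- The core estimate, kept general in σ, e and S because the size bound uses (s₁, 1) and the
regularity bound (s₁-α, 1-α) in the first slot. -/
lemma exists_lintegral_profileForm (hn : 1 ≤ n) {σ₁ σ₂ e₁ e₂ S : ℝ} (hσ₁ : 0 < σ₁)
    (hσ₁' : σ₁ ≤ n) (hσ₂ : 0 < σ₂) (hσ₂' : σ₂ ≤ n) (he₁ : σ₁ ≤ e₁) (he₂ : σ₂ ≤ e₂)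
    (hS : 0 < S) (hS₁ : S < σ₁ + e₂) (hS₂ : S < σ₂ + e₁) (hσS : σ₁ + σ₂ ≤ S) :
    ∃ C : ℝ, 0 ≤ C ∧ ∀ w z : EuclideanSpace ℝ (Fin n), w ≠ z →
      ∫⁻ p, ENNReal.ofReal (profileForm n σ₁ e₁ σ₂ e₂ S w z p) ≤
      ENNReal.ofReal (C * ‖w - z‖ ^ (σ₁ + σ₂ - n - S)) := by
  obtain ⟨C₁, hC₁, h₁⟩ := exists_lintegral_profilePair_fst_fst hn hσ₁ hσ₁' hσ₂ hσ₂' he₁ he₂ hS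
    hS₁ hS₂ hσS
  obtain ⟨C₂, hC₂, h₂⟩ := exists_lintegral_profilePair_fst_snd hn hσ₁ hσ₁' hσ₂ hσ₂' he₁ he₂ hS
    hS₁ hS₂ hσS
  refine ⟨C₁ + C₂ + (C₁ + C₂), by positivity, fun w z hwz => ?_⟩
  have hP : ∀ a b t : EuclideanSpace ℝ (Fin n),
      0 ≤ profilePair n σ₁ e₁ σ₂ e₂ S ‖a‖ ‖b‖ ‖t‖ :=
    fun a b t => profilePair_nonneg (norm_nonneg _) (norm_nonneg _) (norm_nonneg _)
  have hsplit : ∀ p : EuclideanSpace ℝ (Fin n) × EuclideanSpace ℝ (Fin n),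
      ENNReal.ofReal (profileForm n σ₁ e₁ σ₂ e₂ S w z p) =
        (ENNReal.ofReal (profilePair n σ₁ e₁ σ₂ e₂ S ‖p.1 - w‖ ‖p.1 - z‖ ‖p.1 - p.2‖) +
        ENNReal.ofReal (profilePair n σ₁ e₁ σ₂ e₂ S ‖p.1 - w‖ ‖p.2 - z‖ ‖p.1 - p.2‖)) +
        (ENNReal.ofReal (profilePair n σ₁ e₁ σ₂ e₂ S ‖p.2 - w‖ ‖p.2 - z‖ ‖p.1 - p.2‖) +
        ENNReal.ofReal (profilePair n σ₁ e₁ σ₂ e₂ S ‖p.2 - w‖ ‖p.1 - z‖ ‖p.1 - p.2‖)) := by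
    intro p
    rw [← ENNReal.ofReal_add (hP _ _ _) (hP _ _ _), ← ENNReal.ofReal_add (hP _ _ _) (hP _ _ _),
      ← ENNReal.ofReal_add (add_nonneg (hP _ _ _) (hP _ _ _))
        (add_nonneg (hP _ _ _) (hP _ _ _))]
    congr 1
    unfold profileForm profilePair
    ring
  have hm : ∀ {f g : EuclideanSpace ℝ (Fin n) × EuclideanSpace ℝ (Fin n) →
      EuclideanSpace ℝ (Fin n)}, Measurable f → Measurable g → Measurable fun p =>
      ENNReal.ofReal (profilePair n σ₁ e₁ σ₂ e₂ S ‖f p‖ ‖g p‖ ‖p.1 - p.2‖) := fun hf hg =>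
    (measurable_profilePair_norm _ _ _ _ _ hf hg (by fun_prop)).ennreal_ofReal
  have hx : ∀ v : EuclideanSpace ℝ (Fin n), Measurable fun p :
      EuclideanSpace ℝ (Fin n) × EuclideanSpace ℝ (Fin n) => p.1 - v := fun v => by fun_prop
  have hy : ∀ v : EuclideanSpace ℝ (Fin n), Measurable fun p :
      EuclideanSpace ℝ (Fin n) × EuclideanSpace ℝ (Fin n) => p.2 - v := fun v => by fun_prop
  simp_rw [hsplit]
  rw [lintegral_add_left ((hm (hx w) (hx z)).fun_add (hm (hx w) (hy z))),
    lintegral_add_left (hm (hx w) (hx z)), lintegral_add_left (hm (hy w) (hy z)),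
    lintegral_profilePair_snd_snd,
    lintegral_profilePair_snd_fst, add_mul, add_mul, ENNReal.ofReal_add (by positivity)
      (by positivity), ENNReal.ofReal_add (by positivity) (by positivity)]
  gcongr <;> first | exact h₁ w z hwz | exact h₂ w z hwz

end DoubleIntegrals

/-! ### Pointwise bounds for first and second differences of Riesz kernels. -/

section Increments

variable {n : ℕ}

/-- The profile at the smaller positive radius suffices: the tangent slope n-σ handles τ < r, and
the extra 1 in the constant the case τ ≥ r. The profile at the larger radius is needed when the
smaller radius is 0. -/
lemma abs_rpow_sub_rpow_le {σ r r' τ : ℝ} (hσ : σ < n) (hr : 0 ≤ r) (hr' : 0 ≤ r')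
    (hτ : |r - r'| ≤ τ) :
    |r ^ (σ - n) - r' ^ (σ - n)| ≤
      (1 + n - σ) * (profile n σ 1 r τ + profile n σ 1 r' τ) := by
  wlog h : r ≤ r' generalizing r r'
  · rw [abs_sub_comm, add_comm (profile n σ 1 r τ)]
    exact this hr' hr (by rwa [abs_sub_comm]) (le_of_not_ge h)
  have hτ0 : 0 ≤ τ := (abs_nonneg _).trans hτ
  have hdist : r' - r ≤ τ := by rw [abs_sub_comm] at hτ; exact (le_abs_self _).trans hτ
  have hP := profile_nonneg (n := n) (σ := σ) (e := 1) hr hτ0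
  have hP' := profile_nonneg (n := n) (σ := σ) (e := 1) hr' hτ0
  have ha : σ - n ≠ 0 := by linarith
  rcases hr.eq_or_lt with rfl | hr0
  · rw [Real.zero_rpow ha, zero_sub, abs_neg, abs_of_nonneg (by positivity)]
    rcases hτ0.eq_or_lt with rfl | hτ1
    · have : r' = 0 := by linarith
      rw [this, Real.zero_rpow ha]
      rw [this] at hP'
      exact mul_nonneg (by linarith) (add_nonneg hP hP')
    · have : profile n σ 1 r' τ = r' ^ (σ - n) := by
        rw [profile, max_eq_left (by linarith), div_self hτ1.ne', Real.one_rpow, mul_one]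
      rw [← this]
      nlinarith
  · have hle : r' ^ (σ - n) ≤ r ^ (σ - n) :=
      Real.rpow_le_rpow_of_nonpos hr0 h (by linarith)
    rw [abs_of_nonneg (by linarith)]
    suffices r ^ (σ - n) - r' ^ (σ - n) ≤ (1 + n - σ) * profile n σ 1 r τ by nlinarith
    have hrp : 0 < r ^ (σ - n) := by positivity
    have hr'p : 0 ≤ r' ^ (σ - n) := by positivity
    rw [profile, Real.rpow_one]
    rcases le_or_gt r τ with hrτ | hrτ
    · rw [max_eq_left hrτ, div_self (by linarith)]
      nlinarith
    · rw [max_eq_right hrτ.le]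
      have hr'0 : 0 < r' := by linarith
      have hq : r' ^ (σ - n) = r ^ (σ - n) * (r' / r) ^ (σ - n) := by
        rw [← Real.mul_rpow hr (by positivity)]; field_simp
      -- Tangent line at u = 1 of the convex function u^(σ-n), obtained from log u ≤ u - 1 and σ <
      -- n.
      have hb : 1 + (σ - n) * (r' / r - 1) ≤ (r' / r) ^ (σ - n) := by
        rw [Real.rpow_def_of_pos (by positivity)]
        have h1 := Real.add_one_le_exp (Real.log (r' / r) * (σ - n))
        have h2 := Real.log_le_sub_one_of_pos (show 0 < r' / r by positivity)
        nlinarith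
      have hc : r' / r - 1 ≤ τ / r := by
        rw [div_sub_one hr0.ne']; gcongr
      have hd : 0 ≤ τ / r := by positivity
      have he : 1 - (r' / r) ^ (σ - n) ≤ (1 + n - σ) * (τ / r) := by nlinarith
      rw [hq]
      nlinarith

/-- The truncated ratio m is at most both h/r and t/max(t, r). In m = m^α m^(1-α), the first bound
is used on one factor and the second on the other; r^(-α) is absorbed into σ - α. -/
lemma profile_min_le {σ α r h t : ℝ} (hσ : σ < n) (hα : 0 ≤ α) (hα1 : α ≤ 1) (hr : 0 ≤ r)
    (hh : 0 ≤ h) (ht : 0 ≤ t) :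
    profile n σ 1 r (min h t) ≤ h ^ α * profile n (σ - α) (1 - α) r t := by
  rcases hr.eq_or_lt with rfl | hr0
  · have : profile n σ 1 0 (min h t) = 0 := by
      rw [profile, Real.zero_rpow (by linarith), zero_mul]
    rw [this]
    exact mul_nonneg (by positivity) (profile_nonneg le_rfl ht)
  · have hm0 : 0 ≤ min h t := le_min hh ht
    set m := min h t / max (min h t) r with hm
    have hmn : 0 ≤ m := div_max_nonneg hm0
    have h1 : m ≤ h / r := div_le_div₀ hh (min_le_left _ _) hr0 (le_max_right _ _)
    have h2 : m ≤ t / max t r := by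
      rw [hm, div_le_div_iff₀ (lt_max_of_lt_right hr0) (lt_max_of_lt_right hr0),
        mul_max_of_nonneg _ _ hm0, mul_max_of_nonneg _ _ ht]
      refine max_le (le_max_of_le_left (mul_comm _ _).le) (le_max_of_le_right ?_)
      exact mul_le_mul_of_nonneg_right (min_le_right _ _) hr
    have h3 : m = m ^ α * m ^ (1 - α) := by
      rw [← Real.rpow_add_of_nonneg hmn hα (by linarith), add_sub_cancel, Real.rpow_one]
    have h4 : m ≤ (h / r) ^ α * (t / max t r) ^ (1 - α) := by
      rw [h3]
      gcongr
    calc profile n σ 1 r (min h t) = r ^ (σ - n) * m := by rw [profile, Real.rpow_one]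
      _ ≤ r ^ (σ - n) * ((h / r) ^ α * (t / max t r) ^ (1 - α)) := by gcongr
      _ = _ := by
        rw [profile, Real.div_rpow hh hr, show σ - α - n = (σ - n) - α by ring,
          Real.rpow_sub hr0 (σ - n) α]
        ring

lemma abs_norm_sub_rpow_sub_le {σ : ℝ} (hσ : σ < n) (z x y : EuclideanSpace ℝ (Fin n)) :
    |‖x - z‖ ^ (σ - n) - ‖y - z‖ ^ (σ - n)| ≤ (1 + n - σ) *
      (profile n σ 1 ‖x - z‖ ‖x - y‖ + profile n σ 1 ‖y - z‖ ‖x - y‖) :=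
  abs_rpow_sub_rpow_le hσ (norm_nonneg _) (norm_nonneg _)
    ((abs_norm_sub_norm_le _ _).trans_eq (by rw [sub_sub_sub_cancel_right]))

/-- The second difference of `‖·‖ ^ (σ - n)`, with a gain of `‖h‖ ^ α`. -/
lemma abs_norm_sub_rpow_second_difference_le {σ α : ℝ} (hσ : σ < n) (hα : 0 ≤ α) (hα1 : α ≤ 1)
    (z h x y : EuclideanSpace ℝ (Fin n)) :
    |(‖x - (z + h)‖ ^ (σ - n) - ‖y - (z + h)‖ ^ (σ - n)) -
        (‖x - z‖ ^ (σ - n) - ‖y - z‖ ^ (σ - n))| ≤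
      (1 + n - σ) * ‖h‖ ^ α *
        ((profile n (σ - α) (1 - α) ‖x - (z + h)‖ ‖x - y‖ +
            profile n (σ - α) (1 - α) ‖y - (z + h)‖ ‖x - y‖) +
          (profile n (σ - α) (1 - α) ‖x - z‖ ‖x - y‖ +
            profile n (σ - α) (1 - α) ‖y - z‖ ‖x - y‖)) := by
  have hc : 0 ≤ 1 + n - σ := by linarith
  have hmin : ∀ v : EuclideanSpace ℝ (Fin n), profile n σ 1 ‖v‖ (min ‖h‖ ‖x - y‖) ≤
      ‖h‖ ^ α * profile n (σ - α) (1 - α) ‖v‖ ‖x - y‖ := fun v =>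
    profile_min_le hσ hα hα1 (norm_nonneg _) (norm_nonneg _) (norm_nonneg _)
  have hsum := mul_le_mul_of_nonneg_left (add_le_add
    (add_le_add (hmin (x - (z + h))) (hmin (y - (z + h))))
    (add_le_add (hmin (x - z)) (hmin (y - z)))) hc
  refine le_trans ?_ (hsum.trans_eq (by ring))
  -- The four terms are paired along the shorter step: along h at fixed x and y, or along x - y at
  -- fixed centre.
  rcases le_total ‖h‖ ‖x - y‖ with hle | hle
  · rw [min_eq_left hle]
    have hshift : ∀ v : EuclideanSpace ℝ (Fin n),
        |‖v - (z + h)‖ ^ (σ - n) - ‖v - z‖ ^ (σ - n)| ≤ (1 + n - σ) *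
          (profile n σ 1 ‖v - (z + h)‖ ‖h‖ + profile n σ 1 ‖v - z‖ ‖h‖) := fun v =>
      abs_rpow_sub_rpow_le hσ (norm_nonneg _) (norm_nonneg _)
        ((abs_norm_sub_norm_le _ _).trans_eq (by
          rw [sub_sub_sub_cancel_left, sub_add_cancel_left, norm_neg]))
    rw [sub_sub_sub_comm]
    refine (abs_sub _ _).trans ?_
    linarith [hshift x, hshift y]
  · rw [min_eq_right hle]
    refine (abs_sub _ _).trans ?_
    linarith [abs_norm_sub_rpow_sub_le hσ (z + h) x y, abs_norm_sub_rpow_sub_le hσ z x y]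

end Increments

/-! ### Size and regularity of the kernel. -/

section Kernel

variable {n : ℕ} {s s₁ s₂ : ℝ} {K : EuclideanSpace ℝ (Fin n) × EuclideanSpace ℝ (Fin n) → ℝ}

lemma abs_nonlocalIntegrand_le (hs₁ : s₁ < n) (hs₂ : s₂ < n) (z₁ z₂ : EuclideanSpace ℝ (Fin n))
    (p : EuclideanSpace ℝ (Fin n) × EuclideanSpace ℝ (Fin n)) :
    |nonlocalIntegrand n s s₁ s₂ K z₁ z₂ p| ≤
      |K p| * ((1 + n - s₁) * (1 + n - s₂) * profileForm n s₁ 1 s₂ 1 (2 * s) z₁ z₂ p) := by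
  have h1 := abs_norm_sub_rpow_sub_le hs₁ z₁ p.1 p.2
  have h2 := abs_norm_sub_rpow_sub_le hs₂ z₂ p.1 p.2
  have ht : 0 ≤ ‖p.1 - p.2‖ ^ (-(n + 2 * s)) := Real.rpow_nonneg (norm_nonneg _) _
  have h := mul_le_mul_of_nonneg_left (mul_le_mul h1 h2 (abs_nonneg _)
    ((abs_nonneg _).trans h1)) (mul_nonneg (abs_nonneg (K p)) ht)
  unfold nonlocalIntegrand profileForm
  rw [div_eq_mul_inv, ← Real.rpow_neg (norm_nonneg _), abs_mul, abs_mul, abs_mul, abs_of_nonneg ht]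
  refine le_trans (le_of_eq (by ring)) (h.trans_eq (by ring))

lemma abs_nonlocalIntegrand_sub_le {α : ℝ} (hs₁ : s₁ < n) (hs₂ : s₂ < n) (hα : 0 ≤ α)
    (hα1 : α ≤ 1) (z₁ z₂ h : EuclideanSpace ℝ (Fin n))
    (p : EuclideanSpace ℝ (Fin n) × EuclideanSpace ℝ (Fin n)) :
    |nonlocalIntegrand n s s₁ s₂ K (z₁ + h) z₂ p - nonlocalIntegrand n s s₁ s₂ K z₁ z₂ p| ≤
      |K p| * ((1 + n - s₁) * (1 + n - s₂) * ‖h‖ ^ α *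
        (profileForm n (s₁ - α) (1 - α) s₂ 1 (2 * s) (z₁ + h) z₂ p +
          profileForm n (s₁ - α) (1 - α) s₂ 1 (2 * s) z₁ z₂ p)) := by
  have h1 := abs_norm_sub_rpow_second_difference_le hs₁ hα hα1 z₁ h p.1 p.2
  have h2 := abs_norm_sub_rpow_sub_le hs₂ z₂ p.1 p.2
  have ht : 0 ≤ ‖p.1 - p.2‖ ^ (-(n + 2 * s)) := Real.rpow_nonneg (norm_nonneg _) _
  have hb := mul_le_mul_of_nonneg_left (mul_le_mul h1 h2 (abs_nonneg _)
    ((abs_nonneg _).trans h1)) (mul_nonneg (abs_nonneg (K p)) ht)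
  unfold nonlocalIntegrand profileForm
  rw [div_eq_mul_inv, div_eq_mul_inv, ← Real.rpow_neg (norm_nonneg _), ← sub_mul, ← mul_sub,
    ← sub_mul, abs_mul, abs_mul, abs_mul, abs_of_nonneg ht]
  refine le_trans (le_of_eq (by ring)) (hb.trans_eq (by ring))

lemma aestronglyMeasurable_nonlocalIntegrand (hK : AEStronglyMeasurable K volume)
    (z₁ z₂ : EuclideanSpace ℝ (Fin n)) :
    AEStronglyMeasurable (nonlocalIntegrand n s s₁ s₂ K z₁ z₂) volume := by
  unfold nonlocalIntegrand
  have h1 : Measurable fun p : EuclideanSpace ℝ (Fin n) × EuclideanSpace ℝ (Fin n) =>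
      ((‖p.1 - z₁‖ ^ (s₁ - (n : ℝ)) - ‖p.2 - z₁‖ ^ (s₁ - (n : ℝ))) *
      (‖p.1 - z₂‖ ^ (s₂ - (n : ℝ)) - ‖p.2 - z₂‖ ^ (s₂ - (n : ℝ)))) := by fun_prop
  have h2 : Measurable fun p : EuclideanSpace ℝ (Fin n) × EuclideanSpace ℝ (Fin n) =>
      ‖p.1 - p.2‖ ^ ((n : ℝ) + 2 * s) := by fun_prop
  exact ((hK.aemeasurable.mul h1.aemeasurable).div h2.aemeasurable).aestronglyMeasurable

lemma linftyNorm_nonneg : 0 ≤ linftyNorm n K := ENNReal.toReal_nonneg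

lemma ae_abs_le_linftyNorm (hK : MemLp K ∞ volume) : ∀ᵐ p, |K p| ≤ linftyNorm n K := by
  filter_upwards [ae_le_eLpNormEssSup (f := K) (μ := volume)] with p hp
  rw [← eLpNorm_exponent_top] at hp
  have := ENNReal.toReal_mono hK.2.ne hp
  rwa [toReal_enorm, Real.norm_eq_abs] at this

lemma lintegral_enorm_le_of_ae_abs_le {X : Type*} [MeasurableSpace X] {μ : Measure X}
    {f g k : X → ℝ} {M c : ℝ} (hM : 0 ≤ M) (hk : ∀ᵐ x ∂μ, |k x| ≤ M) (hg : ∀ x, 0 ≤ g x)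
    (hf : ∀ x, |f x| ≤ |k x| * g x) (hint : ∫⁻ x, ENNReal.ofReal (g x) ∂μ ≤ ENNReal.ofReal c) :
    ∫⁻ x, ENNReal.ofReal ‖f x‖ ∂μ ≤ ENNReal.ofReal (M * c) := by
  calc ∫⁻ x, ENNReal.ofReal ‖f x‖ ∂μ ≤ ∫⁻ x, ENNReal.ofReal M * ENNReal.ofReal (g x) ∂μ := by
        refine lintegral_mono_ae (hk.mono fun x hx => ?_)
        rw [← ENNReal.ofReal_mul hM]
        exact ENNReal.ofReal_le_ofReal ((hf x).trans (mul_le_mul_of_nonneg_right hx (hg x)))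
    _ ≤ ENNReal.ofReal (M * c) := by
        rw [lintegral_const_mul' _ _ ENNReal.ofReal_ne_top, ENNReal.ofReal_mul hM]
        gcongr

lemma abs_integral_le_of_lintegral_le {X : Type*} [MeasurableSpace X] {μ : Measure X}
    {f : X → ℝ} {c : ℝ} (hc : 0 ≤ c)
    (hint : ∫⁻ x, ENNReal.ofReal ‖f x‖ ∂μ ≤ ENNReal.ofReal c) : |∫ x, f x ∂μ| ≤ c := by
  rw [← Real.norm_eq_abs]
  refine (norm_integral_le_lintegral_norm f).trans ?_
  exact (ENNReal.toReal_mono ENNReal.ofReal_ne_top hint).trans_eq (ENNReal.toReal_ofReal hc)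

lemma kernelA_eq_integral {z₁ z₂ : EuclideanSpace ℝ (Fin n)}
    (h : Integrable (nonlocalIntegrand n s s₁ s₂ K z₁ z₂) volume) :
    kernelA n s s₁ s₂ K z₁ z₂ = ∫ p, nonlocalIntegrand n s s₁ s₂ K z₁ z₂ p :=
  (integral_prod_symm _ h).symm

lemma kernelA_comm (z₁ z₂ : EuclideanSpace ℝ (Fin n)) :
    kernelA n s s₁ s₂ K z₁ z₂ = kernelA n s s₂ s₁ K z₂ z₁ := by
  unfold kernelA nonlocalIntegrand
  congr! 6
  exact mul_comm _ _

lemma exists_kernelA_size (hn : 1 ≤ n) (hs : s ∈ Set.Ioo (0 : ℝ) 1)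
    (hs₁ : s₁ ∈ Set.Ioo (0 : ℝ) 1) (hs₂ : s₂ ∈ Set.Ioo (0 : ℝ) 1) (hsum : s₁ + s₂ = 2 * s) :
    ∃ C : ℝ, 0 ≤ C ∧ ∀ K : EuclideanSpace ℝ (Fin n) × EuclideanSpace ℝ (Fin n) → ℝ,
      MemLp K ∞ volume → ∀ z₁ z₂ : EuclideanSpace ℝ (Fin n), z₁ ≠ z₂ →
        Integrable (nonlocalIntegrand n s s₁ s₂ K z₁ z₂) volume ∧
        |kernelA n s s₁ s₂ K z₁ z₂| ≤ C * (linftyNorm n K / ‖z₁ - z₂‖ ^ (n : ℝ)) := by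
  have hn' : (1 : ℝ) ≤ n := by exact_mod_cast hn
  obtain ⟨hs0, hs1⟩ := hs
  obtain ⟨hs₁0, hs₁1⟩ := hs₁
  obtain ⟨hs₂0, hs₂1⟩ := hs₂
  obtain ⟨C, hC, h⟩ := exists_lintegral_profileForm hn (σ₁ := s₁) (σ₂ := s₂) (e₁ := 1) (e₂ := 1)
    (S := 2 * s) hs₁0 (by linarith) hs₂0 (by linarith) hs₁1.le hs₂1.le (by linarith) (by linarith)
    (by linarith) hsum.le
  have hc₁ : 0 ≤ 1 + n - s₁ := by linarith
  have hc₂ : 0 ≤ 1 + n - s₂ := by linarith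
  refine ⟨(1 + n - s₁) * (1 + n - s₂) * C, by positivity, fun K hK z₁ z₂ hz => ?_⟩
  have hF := h z₁ z₂ hz
  rw [show s₁ + s₂ - n - 2 * s = -(n : ℝ) by linarith] at hF
  have hbound := lintegral_enorm_le_of_ae_abs_le (μ := volume)
    (f := nonlocalIntegrand n s s₁ s₂ K z₁ z₂) (c := (1 + n - s₁) * (1 + n - s₂) *
      (C * ‖z₁ - z₂‖ ^ (-(n : ℝ))))
    linftyNorm_nonneg (ae_abs_le_linftyNorm hK)
    (fun p => mul_nonneg (mul_nonneg hc₁ hc₂) (profileForm_nonneg s₁ 1 s₂ 1 (2 * s) z₁ z₂ p))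
    (abs_nonlocalIntegrand_le (by linarith) (by linarith) z₁ z₂) (by
      simp_rw [ENNReal.ofReal_mul (mul_nonneg hc₁ hc₂)]
      rw [lintegral_const_mul' _ _ ENNReal.ofReal_ne_top]
      gcongr)
  have hint : Integrable (nonlocalIntegrand n s s₁ s₂ K z₁ z₂) volume :=
    ⟨aestronglyMeasurable_nonlocalIntegrand hK.1 z₁ z₂,
      (hasFiniteIntegral_iff_norm _).2 (hbound.trans_lt ENNReal.ofReal_lt_top)⟩
  refine ⟨hint, ?_⟩
  rw [kernelA_eq_integral hint]
  refine (abs_integral_le_of_lintegral_le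
    (mul_nonneg linftyNorm_nonneg (by positivity)) hbound).trans_eq ?_
  rw [Real.rpow_neg (norm_nonneg _)]
  ring

/-- The core estimate is used with σ₁ = s₁-α, e₁ = 1-α and S = 2s. Then α < s₁ keeps σ₁ positive, α
< 1-s₂ is S < σ₁ + e₂, and α < 1-s₁ is S < σ₂ + e₁. -/
lemma exists_kernelA_regularity {α : ℝ} (hn : 1 ≤ n) (hs : s ∈ Set.Ioo (0 : ℝ) 1)
    (hs₁ : s₁ ∈ Set.Ioo (0 : ℝ) 1) (hs₂ : s₂ ∈ Set.Ioo (0 : ℝ) 1) (hsum : s₁ + s₂ = 2 * s)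
    (hα : 0 ≤ α) (hαs₁ : α < s₁) (hα₁ : α < 1 - s₁) (hα₂ : α < 1 - s₂) :
    ∃ C : ℝ, 0 ≤ C ∧ ∀ K : EuclideanSpace ℝ (Fin n) × EuclideanSpace ℝ (Fin n) → ℝ,
      MemLp K ∞ volume → ∀ z₁ z₂ : EuclideanSpace ℝ (Fin n), z₁ ≠ z₂ →
        ∀ h : EuclideanSpace ℝ (Fin n), ‖h‖ ≤ 1 / 2 * ‖z₁ - z₂‖ →
          |kernelA n s s₁ s₂ K (z₁ + h) z₂ - kernelA n s s₁ s₂ K z₁ z₂| ≤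
            C * (‖h‖ ^ α * linftyNorm n K / ‖z₁ - z₂‖ ^ ((n : ℝ) + α)) := by
  have hn' : (1 : ℝ) ≤ n := by exact_mod_cast hn
  obtain ⟨_, _, hsize⟩ := exists_kernelA_size hn hs hs₁ hs₂ hsum
  obtain ⟨hs0, hs1⟩ := hs
  obtain ⟨hs₁0, hs₁1⟩ := hs₁
  obtain ⟨hs₂0, hs₂1⟩ := hs₂
  obtain ⟨C, hC, hform⟩ := exists_lintegral_profileForm hn (σ₁ := s₁ - α) (σ₂ := s₂)
    (e₁ := 1 - α) (e₂ := 1) (S := 2 * s) (by linarith) (by linarith) hs₂0 (by linarith)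
    (by linarith) hs₂1.le (by linarith) (by linarith) (by linarith) (by linarith)
  have hc₁ : 0 ≤ 1 + n - s₁ := by linarith
  have hc₂ : 0 ≤ 1 + n - s₂ := by linarith
  -- The power of 1/2 pays for replacing |z₁+h-z₂| by |z₁-z₂|/2 in the form centred at z₁ + h.
  refine ⟨(1 + n - s₁) * (1 + n - s₂) * (C * 2⁻¹ ^ (-((n : ℝ) + α)) + C), by positivity,
    fun K hK z₁ z₂ hz h hh => ?_⟩
  have hd : 0 < ‖z₁ - z₂‖ := norm_pos_iff.2 (sub_ne_zero.2 hz)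
  have hfar : ‖z₁ - z₂‖ * 2⁻¹ ≤ ‖z₁ + h - z₂‖ := by
    have : ‖z₁ - z₂‖ ≤ ‖z₁ + h - z₂‖ + ‖h‖ := by
      calc ‖z₁ - z₂‖ = ‖(z₁ + h - z₂) - h‖ := by congr 1; abel
        _ ≤ _ := norm_sub_le _ _
    linarith
  have hz' : z₁ + h ≠ z₂ := sub_ne_zero.1 (norm_pos_iff.1 (by linarith))
  have hexp : s₁ - α + s₂ - n - 2 * s = -((n : ℝ) + α) := by linarith
  have hF := hform z₁ z₂ hz
  have hF' := hform (z₁ + h) z₂ hz'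
  rw [hexp] at hF hF'
  replace hF' : ∫⁻ p, ENNReal.ofReal
      (profileForm n (s₁ - α) (1 - α) s₂ 1 (2 * s) (z₁ + h) z₂ p) ≤
      ENNReal.ofReal (C * (‖z₁ - z₂‖ ^ (-((n : ℝ) + α)) * 2⁻¹ ^ (-((n : ℝ) + α)))) := by
    refine hF'.trans (ENNReal.ofReal_le_ofReal (mul_le_mul_of_nonneg_left ?_ hC))
    rw [← Real.mul_rpow hd.le (by norm_num)]
    exact Real.rpow_le_rpow_of_nonpos (by positivity) hfar (by linarith)
  have hA : 0 ≤ (1 + n - s₁) * (1 + n - s₂) * ‖h‖ ^ α := by positivity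
  have hbound := lintegral_enorm_le_of_ae_abs_le (μ := volume)
    (f := fun p => nonlocalIntegrand n s s₁ s₂ K (z₁ + h) z₂ p -
      nonlocalIntegrand n s s₁ s₂ K z₁ z₂ p)
    (c := (1 + n - s₁) * (1 + n - s₂) * ‖h‖ ^ α *
      (C * (‖z₁ - z₂‖ ^ (-((n : ℝ) + α)) * 2⁻¹ ^ (-((n : ℝ) + α))) +
        C * ‖z₁ - z₂‖ ^ (-((n : ℝ) + α))))
    linftyNorm_nonneg (ae_abs_le_linftyNorm hK)
    (fun p => mul_nonneg hA (add_nonneg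
      (profileForm_nonneg (s₁ - α) (1 - α) s₂ 1 (2 * s) (z₁ + h) z₂ p)
      (profileForm_nonneg (s₁ - α) (1 - α) s₂ 1 (2 * s) z₁ z₂ p)))
    (abs_nonlocalIntegrand_sub_le (by linarith) (by linarith) hα (by linarith) z₁ z₂ h) (by
      simp_rw [ENNReal.ofReal_mul hA, ENNReal.ofReal_add (profileForm_nonneg _ _ _ _ _ _ _ _)
        (profileForm_nonneg _ _ _ _ _ _ _ _)]
      rw [lintegral_const_mul' _ _ ENNReal.ofReal_ne_top,
        lintegral_add_left (measurable_profileForm _ _ _ _ _ _ _).ennreal_ofReal,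
        ENNReal.ofReal_add (by positivity) (by positivity)]
      gcongr)
  -- Integrability at both centres lets the difference of kernels be written as a single integral.
  have hint := (hsize K hK z₁ z₂ hz).1
  have hint' := (hsize K hK (z₁ + h) z₂ hz').1
  rw [kernelA_eq_integral hint, kernelA_eq_integral hint', ← integral_sub hint' hint]
  refine (abs_integral_le_of_lintegral_le
    (mul_nonneg linftyNorm_nonneg (by positivity)) hbound).trans_eq ?_
  rw [Real.rpow_neg hd.le]
  ring

end Kernel

theorem proposition1p2 (n : ℕ) (hn : 1 ≤ n) (s s₁ s₂ : ℝ)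
    (hs : s ∈ Set.Ioo (0 : ℝ) 1) (hs₁ : s₁ ∈ Set.Ioo (0 : ℝ) 1) (hs₂ : s₂ ∈ Set.Ioo (0 : ℝ) 1)
    (hsum : s₁ + s₂ = 2 * s) :
    ∃ α : ℝ, 0 < α ∧ ∃ C : ℝ, 0 < C ∧
      ∀ K : EuclideanSpace ℝ (Fin n) × EuclideanSpace ℝ (Fin n) → ℝ, MemLp K ∞ volume →
        ∀ z₁ z₂ : EuclideanSpace ℝ (Fin n), z₁ ≠ z₂ →
          -- the double integral defining the kernel converges absolutely
          Integrable (nonlocalIntegrand n s s₁ s₂ K z₁ z₂) volume ∧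
          -- size condition
          |kernelA n s s₁ s₂ K z₁ z₂| ≤ C * (linftyNorm n K / ‖z₁ - z₂‖ ^ (n : ℝ)) ∧
          -- regularity in the first and in the second variable
          ∀ h : EuclideanSpace ℝ (Fin n), ‖h‖ ≤ 1 / 2 * ‖z₁ - z₂‖ →
            |kernelA n s s₁ s₂ K (z₁ + h) z₂ - kernelA n s s₁ s₂ K z₁ z₂| ≤
              C * (‖h‖ ^ α * linftyNorm n K / ‖z₁ - z₂‖ ^ ((n : ℝ) + α)) ∧
            |kernelA n s s₁ s₂ K z₁ (z₂ + h) - kernelA n s s₁ s₂ K z₁ z₂| ≤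
              C * (‖h‖ ^ α * linftyNorm n K / ‖z₁ - z₂‖ ^ ((n : ℝ) + α)) := by
  obtain ⟨α, hα0, hα₁, hα₂, hα₁', hα₂'⟩ :
      ∃ α : ℝ, 0 < α ∧ α < s₁ ∧ α < s₂ ∧ α < 1 - s₁ ∧ α < 1 - s₂ := by
    obtain ⟨a, ha, ha'⟩ := exists_between (lt_min (lt_min hs₁.1 hs₂.1)
      (lt_min (sub_pos.2 hs₁.2) (sub_pos.2 hs₂.2)))
    simp only [lt_min_iff] at ha'
    exact ⟨a, ha, ha'.1.1, ha'.1.2, ha'.2.1, ha'.2.2⟩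
  obtain ⟨C₀, hC₀, hsize⟩ := exists_kernelA_size hn hs hs₁ hs₂ hsum
  obtain ⟨C₁, hC₁, hreg₁⟩ := exists_kernelA_regularity hn hs hs₁ hs₂ hsum hα0.le hα₁ hα₁' hα₂'
  obtain ⟨C₂, hC₂, hreg₂⟩ := exists_kernelA_regularity hn hs hs₂ hs₁
    (by rw [add_comm, hsum]) hα0.le hα₂ hα₂' hα₁'
  refine ⟨α, hα0, C₀ + C₁ + C₂ + 1, by positivity, fun K hK z₁ z₂ hz => ?_⟩
  have hM : 0 ≤ linftyNorm n K := linftyNorm_nonneg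
  refine ⟨(hsize K hK z₁ z₂ hz).1, (hsize K hK z₁ z₂ hz).2.trans ?_,
    fun h hh => ⟨(hreg₁ K hK z₁ z₂ hz h hh).trans ?_, ?_⟩⟩
  · exact mul_le_mul_of_nonneg_right (by linarith) (by positivity)
  · exact mul_le_mul_of_nonneg_right (by linarith) (by positivity)
  -- Regularity in the second variable is regularity in the first with the roles of (s₁, z₁) and
  -- (s₂, z₂) exchanged.
  · rw [kernelA_comm z₁ (z₂ + h), kernelA_comm z₁ z₂, norm_sub_rev z₁ z₂]
    rw [norm_sub_rev z₁ z₂] at hh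
    exact (hreg₂ K hK z₂ z₁ hz.symm h hh).trans
      (mul_le_mul_of_nonneg_right (by linarith) (by positivity))
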